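/- For $n\ge 1$ and a real number $\zeta$, let $\widehat{w}_n(\zeta)$ be the supremum of the real $\nu$ such that for all sufficiently large real $X$ the system $$\max\{|x|,|y_1|,\dots,|y_n|\}\le X,\qquad |x+\zeta y_1+\zeta^2y_2+\cdots+\zeta^n y_n|\le X^{-\nu}$$ has a nonzero integer solution $(x,y_1,\dots,y_n)\in\mathbb{Z}^{n+1}$. The height $H(P)$ of $P\in\mathbb{Z}[X]$ is the maximum of the absolute values of its coefficients. A nonzero $P\in\mathbb{Z}[X]$ of degree at most $n$ is called a best approximation for $(n,\zeta)$ if there is no nonzero $Q\in\mathbb{Z}[X]$ of degree at most $n$ with $H(Q)<H(P)$ and $|Q(\zeta)|<|P(\zeta)|$. For transcendental $\zeta$, the best approximations for $(n,\zeta)$, taken up to sign, form a sequence $P_1,P_2,\dots$ with $|P_1(\zeta)|>|P_2(\zeta)|>\cdots$ and $H(P_1)\le H(P_2)\le\cdots$. Assume the following conjecture: for every $n\ge 1$ and every transcendental real $\zeta$, there are infinitely many $k$ such that the $n+1$ successive best approximations $P_k,P_{k+1},\dots,P_{k+n}$ for $(n,\zeta)$ are linearly independent (that is, their coefficient vectors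 span $\mathbb{R}^{n+1}$). Then for every $\epsilon>0$ there exists $n_0=n_0(\epsilon)$ such that for all $n\ge n_0$ and all transcendental real $\zeta$ $$\widehat{w}_n(\zeta)\le 2n-1-\log 2+\epsilon .$$ -/

import Mathlib

open Polynomial Filter

/-- `P` is a best approximation for `(n, ζ)`: a nonzero integer polynomial of degree at most `n`
such that no nonzero integer polynomial `Q` of degree at most `n` and of strictly smaller height
satisfies `|Q(ζ)| < |P(ζ)|`. The height is the maximum modulus of the coefficients. -/
def IsBestApprox (n : ℕ) (ζ : ℝ) (P : ℤ[X]) : Prop :=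
  P ≠ 0 ∧ P.natDegree ≤ n ∧
    ∀ Q : ℤ[X], Q ≠ 0 → Q.natDegree ≤ n → Q.supNorm < P.supNorm → ¬ |aeval ζ Q| < |aeval ζ P|

/-- `P 0, P 1, …` is the sequence of best approximations for `(n, ζ)`: it lists all of them, one
from each pair `±Q`, in the order of strictly decreasing `|P k (ζ)|` (so that the heights do not
decrease). -/
structure IsBestApproxSeq (n : ℕ) (ζ : ℝ) (P : ℕ → ℤ[X]) : Prop where
  best : ∀ k, IsBestApprox n ζ (P k)
  strictAnti : StrictAnti fun k => |aeval ζ (P k)|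
  monotone : Monotone fun k => (P k).supNorm
  exhaustive : ∀ Q, IsBestApprox n ζ Q → ∃ k, Q = P k ∨ Q = -P k

/-- Every transcendental real number has a sequence of best approximations, so the quantifier over
such sequences in `BestApproxConjecture` below is never void. -/
theorem exists_isBestApproxSeq (n : ℕ) (hn : 1 ≤ n) (ζ : ℝ) (hζ : Transcendental ℤ ζ) :
    ∃ P : ℕ → ℤ[X], IsBestApproxSeq n ζ P := by
  classical
  have hval : ∀ Q : ℤ[X], Q ≠ 0 → 0 < |aeval ζ Q| := fun Q hQ =>
    abs_pos.2 fun h => hQ ((transcendental_iff.1 hζ) Q h)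
  have hdir : ∀ c : ℝ, 0 < c → ∃ Q : ℤ[X], Q ≠ 0 ∧ Q.natDegree ≤ n ∧ |aeval ζ Q| < c := by
    intro c hc
    obtain ⟨N, hN⟩ := exists_nat_one_div_lt hc
    obtain ⟨j, k, hk, -, h⟩ := Real.exists_int_int_abs_mul_sub_le ζ (Nat.succ_pos N)
    refine ⟨C k * X + C (-j), ?_, (natDegree_linear_le).trans hn, ?_⟩
    · intro h0
      have := congrArg (fun p : ℤ[X] => p.coeff 1) h0
      simp only [coeff_add, coeff_C_mul, coeff_X_one, coeff_C_succ, coeff_zero] at this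
      omega
    · have : aeval ζ (C k * X + C (-j) : ℤ[X]) = k * ζ - j := by
        simp [sub_eq_add_neg]
      rw [this]
      refine (h.trans ?_).trans_lt hN
      push_cast
      apply one_div_le_one_div_of_le <;> linarith [(Nat.cast_nonneg N : (0:ℝ) ≤ N)]
  have hfinH : ∀ h : ℝ, {Q : ℤ[X] | Q.natDegree ≤ n ∧ Q.supNorm ≤ h}.Finite := by
    intro h
    refine Set.Finite.of_finite_image (f := fun Q : ℤ[X] => fun i : Fin (n + 1) => Q.coeff i)
      ((Set.finite_Icc (fun _ : Fin (n + 1) => -⌈h⌉) (fun _ => ⌈h⌉)).subset ?_) ?_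
    · rintro _ ⟨Q, ⟨-, hQ⟩, rfl⟩
      have key : ∀ i, |Q.coeff i| ≤ ⌈h⌉ := by
        intro i
        have h1 := (Q.le_supNorm i).trans (hQ.trans (Int.le_ceil h))
        rw [Int.norm_eq_abs] at h1
        exact_mod_cast h1
      exact ⟨fun i => (abs_le.1 (key i)).1, fun i => (abs_le.1 (key i)).2⟩
    · rintro Q ⟨hQ, -⟩ R ⟨hR, -⟩ hQR
      ext i
      by_cases hi : i < n + 1
      · exact congrFun hQR ⟨i, hi⟩
      · rw [coeff_eq_zero_of_natDegree_lt (by omega), coeff_eq_zero_of_natDegree_lt (by omega)]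
  have hfin : ∀ c : ℝ, 0 < c → {Q : ℤ[X] | IsBestApprox n ζ Q ∧ c ≤ |aeval ζ Q|}.Finite := by
    intro c hc
    obtain ⟨Q, hQ0, hQn, hQc⟩ := hdir c hc
    refine (hfinH Q.supNorm).subset ?_
    rintro P ⟨hP, hPc⟩
    refine ⟨hP.2.1, not_lt.1 fun hlt => hP.2.2 Q hQ0 hQn hlt (hQc.trans_le hPc)⟩
  have hex : ∀ c : ℝ, 0 < c → ∃ P, IsBestApprox n ζ P ∧ |aeval ζ P| < c := by
    intro c hc
    obtain ⟨Q, hQ0, hQn, hQc⟩ := hdir c hc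
    obtain ⟨P, ⟨⟨hPn, hPh⟩, hP0, hPc⟩, hmin⟩ := Set.exists_min_image
      ({R : ℤ[X] | R.natDegree ≤ n ∧ R.supNorm ≤ Q.supNorm} ∩ {R | R ≠ 0 ∧ |aeval ζ R| < c})
      (fun R => R.supNorm) ((hfinH _).inter_of_left _) ⟨Q, ⟨hQn, le_rfl⟩, hQ0, hQc⟩
    refine ⟨P, ⟨hP0, hPn, fun R hR0 hRn hlt hv => ?_⟩, hPc⟩
    exact absurd (hmin R ⟨⟨hRn, hlt.le.trans hPh⟩, hR0, hv.trans hPc⟩) (not_le.2 hlt)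
  -- the best approximation with the largest value below a given bound
  have hnext : ∀ c : ℝ, 0 < c → ∃ P, IsBestApprox n ζ P ∧ |aeval ζ P| < c ∧
      ∀ Q, IsBestApprox n ζ Q → |aeval ζ Q| < c → |aeval ζ Q| ≤ |aeval ζ P| := by
    intro c hc
    obtain ⟨P₀, hP₀, hP₀c⟩ := hex c hc
    obtain ⟨P, ⟨⟨hP, hPv⟩, hPc⟩, hmax⟩ := Set.exists_max_image
      ({Q : ℤ[X] | IsBestApprox n ζ Q ∧ |aeval ζ P₀| ≤ |aeval ζ Q|} ∩ {Q | |aeval ζ Q| < c})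
      (fun Q => |aeval ζ Q|) ((hfin _ (hval _ hP₀.1)).inter_of_left _) ⟨P₀, ⟨hP₀, le_rfl⟩, hP₀c⟩
    refine ⟨P, hP, hPc, fun Q hQ hQc => ?_⟩
    rcases le_total |aeval ζ P₀| |aeval ζ Q| with h | h
    · exact hmax Q ⟨⟨hQ, h⟩, hQc⟩
    · exact h.trans hPv
  have hfirst : ∃ P, IsBestApprox n ζ P ∧ ∀ Q, IsBestApprox n ζ Q → |aeval ζ Q| ≤ |aeval ζ P| := by
    obtain ⟨P₀, hP₀, -⟩ := hex 1 one_pos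
    obtain ⟨P, ⟨hP, hPv⟩, hmax⟩ := Set.exists_max_image _ (fun Q => |aeval ζ Q|)
      (hfin _ (hval _ hP₀.1)) ⟨P₀, hP₀, le_rfl⟩
    refine ⟨P, hP, fun Q hQ => ?_⟩
    rcases le_total |aeval ζ P₀| |aeval ζ Q| with h | h
    · exact hmax Q ⟨hQ, h⟩
    · exact h.trans hPv
  obtain ⟨A, hA, hAmax⟩ := hfirst
  have hstep : ∀ P : {P : ℤ[X] // IsBestApprox n ζ P}, ∃ R : {P : ℤ[X] // IsBestApprox n ζ P},
      |aeval ζ R.1| < |aeval ζ P.1| ∧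
      ∀ Q, IsBestApprox n ζ Q → |aeval ζ Q| < |aeval ζ P.1| → |aeval ζ Q| ≤ |aeval ζ R.1| := by
    intro P
    obtain ⟨R, hR, h1, h2⟩ := hnext _ (hval _ P.2.1)
    exact ⟨⟨R, hR⟩, h1, h2⟩
  choose g hg1 hg2 using hstep
  let S : ℕ → {P : ℤ[X] // IsBestApprox n ζ P} := fun k => g^[k] ⟨A, hA⟩
  have hS : ∀ k, S (k + 1) = g (S k) := fun k => Function.iterate_succ_apply' g k _
  have hanti : StrictAnti fun k => |aeval ζ (S k).1| :=
    strictAnti_nat_of_succ_lt fun k => by rw [hS]; exact hg1 _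
  refine ⟨fun k => (S k).1, fun k => (S k).2, hanti, ?_, fun Q hQ => ?_⟩
  · intro k l hkl
    rcases hkl.eq_or_lt with rfl | hlt
    · exact le_rfl
    · exact not_lt.1 fun h => (S k).2.2.2 _ (S l).2.1 (S l).2.2.1 h (hanti hlt)
  · by_contra! hne
    have habs : ∀ k, |aeval ζ Q| ≠ |aeval ζ (S k).1| := by
      intro k h
      rcases abs_eq_abs.1 h with h | h
      · refine (hne k).1 (sub_eq_zero.1 ?_)
        exact (transcendental_iff.1 hζ) _ (by rw [map_sub, h, sub_self])
      · refine (hne k).2 (eq_neg_of_add_eq_zero_left ?_)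
        exact (transcendental_iff.1 hζ) _ (by rw [map_add, h, neg_add_cancel])
    have hlt : ∀ k, |aeval ζ Q| < |aeval ζ (S k).1| := by
      intro k
      induction k with
      | zero => exact lt_of_le_of_ne (hAmax Q hQ) (habs 0)
      | succ k ih => exact lt_of_le_of_ne (by rw [hS]; exact hg2 _ Q hQ ih) (habs (k + 1))
    refine Set.infinite_range_of_injective
      (fun k l h => hanti.injective (congrArg (fun P : ℤ[X] => |aeval ζ P|) h) :
        Function.Injective fun k => (S k).1) ((hfin _ (hval Q hQ.1)).subset ?_)
    rintro _ ⟨k, rfl⟩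
    exact ⟨(S k).2, (hlt k).le⟩

/-- The conjecture on successive best approximations: for every `n ≥ 1` and every transcendental
real `ζ`, there are infinitely many `k` for which the coefficient vectors in `ℝ ^ (n + 1)` of the
best approximations `P k, P (k + 1), …, P (k + n)` for `(n, ζ)` are linearly independent. -/
def BestApproxConjecture : Prop :=
  ∀ n : ℕ, 1 ≤ n → ∀ ζ : ℝ, Transcendental ℤ ζ →
    ∀ P : ℕ → ℤ[X], IsBestApproxSeq n ζ P →
      {k : ℕ | LinearIndependent ℝ fun i j : Fin (n + 1) =>
        ((P (k + i)).coeff j : ℝ)}.Infinite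

/-- The uniform exponent `ŵ_n(ξ)` of the linear form in `ξ = (ξ₁, …, ξ_n)`: the supremum in
`[-∞, ∞]` of the real `ν` such that for all large real `X` the system
`max {|x|, |y₁|, …, |y_n|} ≤ X`, `|x + ξ₁ y₁ + ⋯ + ξ_n y_n| ≤ X ^ (-ν)`
has a nonzero integer solution. -/
noncomputable def uniformExponent {n : ℕ} (ξ : Fin n → ℝ) : EReal :=
  sSup ((fun ν : ℝ => (ν : EReal)) '' {ν : ℝ | ∀ᶠ X : ℝ in atTop,
    ∃ (x : ℤ) (y : Fin n → ℤ), (x ≠ 0 ∨ y ≠ 0) ∧ |(x : ℝ)| ≤ X ∧ (∀ i, |(y i : ℝ)| ≤ X) ∧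
      |(x : ℝ) + ∑ i, ξ i * (y i : ℝ)| ≤ X ^ (-ν)})

/-- `ŵ_n(ζ) = ŵ_n(ζ, ζ ^ 2, …, ζ ^ n)`. -/
noncomputable def wHat (n : ℕ) (ζ : ℝ) : EReal :=
  uniformExponent fun i : Fin n => ζ ^ ((i : ℕ) + 1)

/-! A uniform exponent near `2n` limits how fast the heights `H_k` of the best approximations can
grow, while independence of a whole block forces fast growth.

Let `ν > 2n - 2` be admissible uniformly, `ν ≤ 2n - 1`, and put `x = (n - 1) / (ν - n)`. Liouville's
inequality, played between an irreducible `P` and a uniform approximation `Q`, shows that `|P(ζ)|`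
is at least a constant times `H(P) ^ (-νx)`. Mahler's measure is multiplicative, so this extends to
all `P` (`exists_le_abs_aeval_mul_supNorm_rpow`). Uniformity gives `|P_k(ζ)| ≪ H_{k+1} ^ (-ν)`; the
two bounds together yield `H_{k+1} ≪ H_k ^ x`.

If `P_k, …, P_{k+n}` are independent, their determinant is a nonzero integer, so `1 ≪ |P_k(ζ)|
H_{k+1} ⋯ H_{k+n}`. The right side is `≪ H_{k+1} ^ (-ν + 1 + x + ⋯ + x ^ (n-1))`. As this happens
for arbitrarily large `k`, `ν ≤ 1 + x + ⋯ + x ^ (n-1)` (`HasUniformApprox.le_geom_sum`).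

For `ν = 2n - 1 - s` one has `x ^ (n-1) → e ^ s`. If `s < log 2` this limit is below `2`, so the sum
is at most `r n` with `r < 2`, which is too small for large `n`. -/

/-! ### Heights, Mahler measure and divisors -/

/-- The Mahler measure of an integer polynomial. -/
noncomputable def intMahlerMeasure (P : ℤ[X]) : ℝ :=
  (P.map (Int.castRingHom ℂ)).mahlerMeasure

theorem one_le_intMahlerMeasure {P : ℤ[X]} (hP : P ≠ 0) : 1 ≤ intMahlerMeasure P :=
  one_le_mahlerMeasure_of_ne_zero hP

theorem intMahlerMeasure_mul (P Q : ℤ[X]) :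
    intMahlerMeasure (P * Q) = intMahlerMeasure P * intMahlerMeasure Q := by
  simp [intMahlerMeasure, Polynomial.map_mul, mahlerMeasure_mul]

theorem supNorm_map_intCast (P : ℤ[X]) : (P.map (Int.castRingHom ℂ)).supNorm = P.supNorm := by
  simp [supNorm_eq_iSup, Int.norm_eq_abs]

theorem natDegree_map_intCast (P : ℤ[X]) :
    (P.map (Int.castRingHom ℂ)).natDegree = P.natDegree :=
  natDegree_map_eq_of_injective (Int.castRingHom ℂ).injective_int P

theorem intMahlerMeasure_le_supNorm {n : ℕ} {P : ℤ[X]} (hP : P.natDegree ≤ n) :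
    intMahlerMeasure P ≤ (n + 1) * P.supNorm := by
  have h := mahlerMeasure_le_sqrt_natDegree_add_one_mul_supNorm (P.map (Int.castRingHom ℂ))
  rw [supNorm_map_intCast, natDegree_map_intCast] at h
  refine h.trans (mul_le_mul_of_nonneg_right ?_ P.supNorm_nonneg)
  have hP' : (P.natDegree : ℝ) ≤ n := by exact_mod_cast hP
  rw [Real.sqrt_le_left (by positivity)]
  nlinarith [(Nat.cast_nonneg n : (0 : ℝ) ≤ n)]

theorem supNorm_le_intMahlerMeasure {n : ℕ} {P : ℤ[X]} (hP : P.natDegree ≤ n) :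
    P.supNorm ≤ 2 ^ n * intMahlerMeasure P := by
  have h := supNorm_le_choose_natDegree_div_two_mul_mahlerMeasure (P.map (Int.castRingHom ℂ))
  rw [supNorm_map_intCast, natDegree_map_intCast] at h
  refine h.trans (mul_le_mul_of_nonneg_right ?_ (mahlerMeasure_nonneg _))
  have h1 : P.natDegree.choose (P.natDegree / 2) ≤ 2 ^ n :=
    (Nat.choose_le_two_pow _ _).trans (Nat.pow_le_pow_right (by norm_num) hP)
  exact_mod_cast h1

theorem one_le_supNorm {P : ℤ[X]} (hP : P ≠ 0) : 1 ≤ P.supNorm := by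
  refine le_trans ?_ (P.le_supNorm P.natDegree)
  rw [Int.norm_eq_abs]
  exact_mod_cast Int.one_le_abs (leadingCoeff_ne_zero.2 hP)

/-- Gelfond's inequality: the height is comparable to the multiplicative Mahler measure, and an
integer cofactor has measure at least `1`. -/
theorem supNorm_le_of_dvd {n : ℕ} {P Q : ℤ[X]} (hQ : Q ≠ 0) (hn : Q.natDegree ≤ n) (h : P ∣ Q) :
    P.supNorm ≤ 2 ^ n * (n + 1) * Q.supNorm := by
  have hdeg : P.natDegree ≤ n := (natDegree_le_of_dvd h hQ).trans hn
  obtain ⟨R, rfl⟩ := h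
  have hR : R ≠ 0 := right_ne_zero_of_mul hQ
  calc P.supNorm ≤ 2 ^ n * intMahlerMeasure P := supNorm_le_intMahlerMeasure hdeg
    _ ≤ 2 ^ n * intMahlerMeasure (P * R) := by
        gcongr
        rw [intMahlerMeasure_mul]
        exact le_mul_of_one_le_right (mahlerMeasure_nonneg _) (one_le_intMahlerMeasure hR)
    _ ≤ 2 ^ n * ((n + 1) * (P * R).supNorm) := by
        gcongr
        exact intMahlerMeasure_le_supNorm hn
    _ = _ := by ring

theorem finite_natDegree_le_supNorm_le (n : ℕ) (h : ℝ) :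
    {P : ℤ[X] | P.natDegree ≤ n ∧ P.supNorm ≤ h}.Finite := by
  refine (finite_mahlerMeasure_le n ((n + 1) * h).toNNReal).subset ?_
  rintro P ⟨hP, hPh⟩
  refine ⟨hP, (intMahlerMeasure_le_supNorm hP).trans (le_trans ?_ (Real.le_coe_toNNReal _))⟩
  gcongr

theorem abs_aeval_pos {ζ : ℝ} (hζ : Transcendental ℤ ζ) {P : ℤ[X]} (hP : P ≠ 0) :
    0 < |aeval ζ P| :=
  abs_pos.2 fun h => hP (transcendental_iff.1 hζ P h)

theorem exists_pos_le_abs_aeval {ζ : ℝ} (hζ : Transcendental ℤ ζ) (n : ℕ) (h : ℝ) :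
    ∃ c : ℝ, 0 < c ∧ ∀ P : ℤ[X], P ≠ 0 → P.natDegree ≤ n → P.supNorm ≤ h → c ≤ |aeval ζ P| := by
  have hf : ({P : ℤ[X] | P.natDegree ≤ n ∧ P.supNorm ≤ h} ∩ {P | P ≠ 0}).Finite :=
    (finite_natDegree_le_supNorm_le n h).inter_of_left _
  rcases Set.eq_empty_or_nonempty
    ({P : ℤ[X] | P.natDegree ≤ n ∧ P.supNorm ≤ h} ∩ {P | P ≠ 0}) with he | hne
  · refine ⟨1, one_pos, fun P h0 h1 h2 => ?_⟩
    exact (Set.eq_empty_iff_forall_notMem.1 he P ⟨⟨h1, h2⟩, h0⟩).elim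
  · obtain ⟨P, hP, hmin⟩ := Set.exists_min_image _ (fun P => |aeval ζ P|) hf hne
    exact ⟨_, abs_aeval_pos hζ hP.2, fun Q h0 h1 h2 => hmin Q ⟨⟨h1, h2⟩, h0⟩⟩

/-! ### Determinants and Liouville's inequality -/

/-- If the coefficient matrix of `N + 1` integer polynomials of degree at most `N` is nonsingular,
then its determinant is at least `1` in modulus; here it is bounded from above in terms of the
heights and of the values at `ζ`. -/
theorem one_le_sum_abs_aeval_div_supNorm (N : ℕ) (ζ : ℝ) (P : Fin (N + 1) → ℤ[X])
    (hdeg : ∀ i, (P i).natDegree ≤ N)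
    (hdet : (Matrix.of fun i j : Fin (N + 1) => (P i).coeff j).det ≠ 0) :
    1 ≤ ((N + 1).factorial : ℝ) *
      ((∑ i, |aeval ζ (P i)| / (P i).supNorm) * ∏ i, (P i).supNorm) := by
  classical
  set A : Matrix (Fin (N + 1)) (Fin (N + 1)) ℤ := Matrix.of fun i j => (P i).coeff j with hA
  have hne : ∀ i, P i ≠ 0 := fun i hi =>
    hdet (Matrix.det_eq_zero_of_row_eq_zero i fun j => by simp [hA, hi])
  set B : Matrix (Fin (N + 1)) (Fin (N + 1)) ℝ := A.map (Int.cast : ℤ → ℝ) with hB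
  have hBdet : B.det = (A.det : ℝ) := (Int.cast_det A).symm
  have hval : ∀ i, ∑ j : Fin (N + 1), ζ ^ (j : ℕ) • B i j = aeval ζ (P i) := by
    intro i
    rw [aeval_eq_sum_range' (Nat.lt_succ_of_le (hdeg i)), Finset.sum_range]
    refine Finset.sum_congr rfl fun j _ => ?_
    simp [hB, hA, mul_comm]
  -- The column of constant terms is replaced by the column of values at `ζ`; its own weight is `ζ ^
  -- 0 = 1`, so the determinant is unchanged.
  have hupd := B.det_updateCol_sum 0 (fun j : Fin (N + 1) => ζ ^ (j : ℕ))
  simp only [hval, Fin.val_zero, pow_zero, one_smul] at hupd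
  have h1 : (1 : ℝ) ≤ |B.det| := by
    rw [hBdet]
    exact_mod_cast Int.one_le_abs hdet
  refine h1.trans ?_
  rw [← hupd, Matrix.det_apply']
  refine (Finset.abs_sum_le_sum_abs _ _).trans ?_
  -- In a Leibniz term the row `σ 0` contributes its value at `ζ` and every other row at most its
  -- height.
  have hterm : ∀ σ : Equiv.Perm (Fin (N + 1)),
      |((Equiv.Perm.sign σ : ℤ) : ℝ) *
        ∏ i, (B.updateCol 0 (fun i => aeval ζ (P i))) (σ i) i| ≤
      (∑ i, |aeval ζ (P i)| / (P i).supNorm) * ∏ i, (P i).supNorm := by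
    intro σ
    have hs : |((Equiv.Perm.sign σ : ℤ) : ℝ)| = 1 := by
      rcases Int.units_eq_one_or (Equiv.Perm.sign σ) with h | h <;> simp [h]
    rw [abs_mul, hs, one_mul, Finset.abs_prod, Fin.prod_univ_succ]
    have hp0 : 0 < (P (σ 0)).supNorm := one_pos.trans_le (one_le_supNorm (hne _))
    calc _ ≤ |aeval ζ (P (σ 0))| * ∏ i : Fin N, (P (σ i.succ)).supNorm := by
          simp only [Matrix.updateCol_self]
          gcongr with i
          rw [Matrix.updateCol_ne (Fin.succ_ne_zero i)]
          have := (P (σ i.succ)).le_supNorm (i.succ : Fin (N + 1))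
          rw [Int.norm_eq_abs] at this
          simpa [hB, hA] using this
      _ = (|aeval ζ (P (σ 0))| / (P (σ 0)).supNorm) * ∏ i, (P (σ i)).supNorm := by
          rw [Fin.prod_univ_succ]
          field_simp
      _ = (|aeval ζ (P (σ 0))| / (P (σ 0)).supNorm) * ∏ i, (P i).supNorm := by
          rw [Equiv.prod_comp σ fun i => (P i).supNorm]
      _ ≤ _ := by
          refine mul_le_mul_of_nonneg_right ?_ (Finset.prod_nonneg fun i _ => supNorm_nonneg _)
          exact Finset.single_le_sum (f := fun i => |aeval ζ (P i)| / (P i).supNorm)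
            (fun i _ => div_nonneg (abs_nonneg _) (supNorm_nonneg _)) (Finset.mem_univ (σ 0))
  refine (Finset.sum_le_sum fun σ _ => hterm σ).trans ?_
  simp [Fintype.card_perm]

theorem supNorm_X_pow_mul (i : ℕ) (P : ℤ[X]) : (X ^ i * P).supNorm = P.supNorm := by
  apply le_antisymm
  · obtain ⟨k, hk⟩ := (X ^ i * P).exists_eq_supNorm
    rw [hk, coeff_X_pow_mul']
    split_ifs
    · exact P.le_supNorm _
    · simpa using P.supNorm_nonneg
  · obtain ⟨k, hk⟩ := P.exists_eq_supNorm
    rw [hk, ← coeff_X_pow_mul P i k]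
    exact le_supNorm _ _

/-- For coprime `P`, `Q` the products `X ^ i * P` and `X ^ j * Q` that make up the Sylvester matrix
are linearly independent. -/
theorem sylvester_family_independent {n m : ℕ} {P Q : ℤ[X]} (hP : Prime P)
    (hPm : P.natDegree = m) (hPQ : ¬ P ∣ Q) (a : Fin n → ℤ) (b : Fin m → ℤ)
    (h : ∑ i, C (a i) * (X ^ (i : ℕ) * P) + ∑ j, C (b j) * (X ^ (j : ℕ) * Q) = 0) :
    a = 0 ∧ b = 0 := by
  have hsum : ∀ (k : ℕ) (c : Fin k → ℤ) (R : ℤ[X]),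
      ∑ i, C (c i) * (X ^ (i : ℕ) * R) = (∑ i, C (c i) * X ^ (i : ℕ)) * R := by
    intro k c R
    rw [Finset.sum_mul]
    exact Finset.sum_congr rfl fun i _ => by ring
  have hzero : ∀ (k : ℕ) (c : Fin k → ℤ), ∑ i, C (c i) * X ^ (i : ℕ) = 0 → c = 0 := by
    intro k c hc
    funext i
    have := congrArg (fun p : ℤ[X] => p.coeff i) hc
    simpa [finsetSum_coeff, coeff_C_mul, coeff_X_pow, Fin.val_inj] using this
  rw [hsum, hsum] at h
  set S := ∑ i, C (a i) * X ^ (i : ℕ)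
  set T := ∑ j, C (b j) * X ^ (j : ℕ) with hT
  have hTd : P ∣ T := by
    have : P ∣ T * Q := (dvd_neg.2 (Dvd.intro_left S rfl)).trans
      (by rw [show T * Q = -(S * P) by linear_combination h])
    exact (hP.dvd_or_dvd this).resolve_right hPQ
  -- `T` has degree below `m = deg P`, so it can be a multiple of `P` only if it vanishes.
  have hT0 : T = 0 := by
    by_contra hne
    have h1 := degree_le_of_dvd hTd hne
    have h2 : T.degree < m := degree_sum_fin_lt b
    rw [degree_eq_natDegree hP.ne_zero, hPm] at h1
    exact absurd h2 (not_lt.2 h1)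
  refine ⟨hzero n a ?_, hzero m b hT0⟩
  rw [hT0, zero_mul, add_zero] at h
  exact (mul_eq_zero.1 h).resolve_right hP.ne_zero

/-- Liouville's inequality for two coprime integer polynomials. -/
theorem one_le_of_prime_of_not_dvd {n m : ℕ} (hm : 1 ≤ m) (hmn : m ≤ n) (ζ : ℝ) {P Q : ℤ[X]}
    (hP : Prime P) (hPm : P.natDegree = m) (hQ : Q.natDegree ≤ n) (hPQ : ¬ P ∣ Q) {Y : ℝ}
    (hY : Q.supNorm ≤ Y) :
    1 ≤ (2 * n).factorial * (n * max 1 |ζ| ^ n) * (P.supNorm ^ (n - 1) * Y ^ m * |aeval ζ P| +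
      P.supNorm ^ n * Y ^ (m - 1) * |aeval ζ Q|) := by
  classical
  obtain ⟨N, hN⟩ : ∃ N, n + m = N + 1 := ⟨n + m - 1, by omega⟩
  have hQ0 : Q ≠ 0 := fun h => hPQ (h ▸ dvd_zero P)
  let e : Fin (N + 1) ≃ Fin n ⊕ Fin m := (finCongr hN.symm).trans finSumFinEquiv.symm
  -- The number of shifts of `P` is the bound `n`, not the degree of `Q`; independence survives when
  -- `deg Q < n`.
  let F : Fin n ⊕ Fin m → ℤ[X] := Sum.elim (fun i => X ^ (i : ℕ) * P) fun j => X ^ (j : ℕ) * Q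
  have hFdeg : ∀ s, (F s).natDegree ≤ N := by
    rintro (i | j)
    · refine natDegree_mul_le.trans ?_
      rw [natDegree_X_pow, hPm]
      have := i.2
      omega
    · refine natDegree_mul_le.trans ?_
      rw [natDegree_X_pow]
      have := j.2
      omega
  have hdet : (Matrix.of fun i j : Fin (N + 1) => (F (e i)).coeff j).det ≠ 0 := by
    intro h0
    obtain ⟨v, hv, hv0⟩ := Matrix.exists_vecMul_eq_zero_iff.2 h0
    have hcomb : ∑ i, C (v i) * F (e i) = 0 := by
      ext k
      by_cases hk : k < N + 1
      · have := congrFun hv0 ⟨k, hk⟩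
        simpa [Matrix.vecMul, dotProduct, finsetSum_coeff] using this
      · rw [finsetSum_coeff, coeff_zero]
        refine Finset.sum_eq_zero fun i _ => ?_
        rw [coeff_C_mul, coeff_eq_zero_of_natDegree_lt (by have := hFdeg (e i); omega), mul_zero]
    rw [← Equiv.sum_comp e.symm, Fintype.sum_sum_type] at hcomb
    simp only [Equiv.apply_symm_apply] at hcomb
    obtain ⟨h1, h2⟩ := sylvester_family_independent hP hPm hPQ (fun i => v (e.symm (Sum.inl i)))
      (fun j => v (e.symm (Sum.inr j))) hcomb
    apply hv
    funext i
    obtain ⟨s, rfl⟩ := e.symm.surjective i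
    rcases s with i | j
    · exact congrFun h1 i
    · exact congrFun h2 j
  have key := one_le_sum_abs_aeval_div_supNorm N ζ (fun i => F (e i)) (fun i => hFdeg _) hdet
  rw [Equiv.sum_comp e fun s => |aeval ζ (F s)| / (F s).supNorm,
    Equiv.prod_comp e fun s => (F s).supNorm, Fintype.sum_sum_type, Fintype.prod_sum_type] at key
  simp only [F, Sum.elim_inl, Sum.elim_inr, supNorm_X_pow_mul, Finset.prod_const,
    Finset.card_univ, Fintype.card_fin, map_mul, map_pow, aeval_X, abs_mul, abs_pow] at key
  have hP1 := one_le_supNorm hP.ne_zero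
  have hQ1 := one_le_supNorm hQ0
  have hK : ∀ i : ℕ, i ≤ n → |ζ| ^ i ≤ max 1 |ζ| ^ n := fun i hi =>
    (pow_le_pow_left₀ (abs_nonneg _) (le_max_right 1 _) i).trans
      (pow_le_pow_right₀ (le_max_left _ _) hi)
  set K := max 1 |ζ| ^ n
  set p := P.supNorm
  set q := Q.supNorm
  have hs1 : ∑ i : Fin n, |ζ| ^ (i : ℕ) * |aeval ζ P| / p ≤ n * (K * |aeval ζ P| / p) := by
    refine (Finset.sum_le_card_nsmul _ _ (K * |aeval ζ P| / p) fun i _ => ?_).trans (by simp)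
    have := hK i i.2.le
    gcongr
  have hs2 : ∑ j : Fin m, |ζ| ^ (j : ℕ) * |aeval ζ Q| / q ≤ n * (K * |aeval ζ Q| / q) := by
    refine (Finset.sum_le_card_nsmul _ _ (K * |aeval ζ Q| / q) fun j _ => ?_).trans ?_
    · have := hK j (j.2.le.trans hmn)
      gcongr
    · have : (m : ℝ) ≤ n := by exact_mod_cast hmn
      simp only [Finset.card_univ, Fintype.card_fin, nsmul_eq_mul]
      gcongr
  have hfac : ((N + 1).factorial : ℝ) ≤ (2 * n).factorial := by
    exact_mod_cast Nat.factorial_le (by omega)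
  obtain ⟨m', rfl⟩ : ∃ m', m = m' + 1 := ⟨m - 1, by omega⟩
  obtain ⟨n', rfl⟩ : ∃ n', n = n' + 1 := ⟨n - 1, by omega⟩
  set n := n' + 1
  have hK0 : 0 ≤ K := by positivity
  have hY1 : 1 ≤ Y := hQ1.trans hY
  calc (1 : ℝ) ≤ _ := key
    _ ≤ (2 * n).factorial * ((n * (K * |aeval ζ P| / p) + n * (K * |aeval ζ Q| / q)) *
          (p ^ n * q ^ (m' + 1))) := by gcongr
    _ = (2 * n).factorial * (n * K) * (p ^ n' * q ^ (m' + 1) * |aeval ζ P| +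
          p ^ n * q ^ m' * |aeval ζ Q|) := by
        simp only [n, pow_succ]
        field_simp
    _ ≤ _ := by
        simp only [n, Nat.add_sub_cancel]
        gcongr

/-! ### From the uniform exponent to a lower bound for all polynomials -/

/-- For every large `X` some nonzero integer polynomial of degree at most `n` and height at most `X`
has modulus at most `X ^ (-ν)` at `ζ`. -/
def HasUniformApprox (n : ℕ) (ζ ν : ℝ) : Prop :=
  ∃ X₀ : ℝ, 1 ≤ X₀ ∧ ∀ X : ℝ, X₀ ≤ X →
    ∃ Q : ℤ[X], Q ≠ 0 ∧ Q.natDegree ≤ n ∧ Q.supNorm ≤ X ∧ |aeval ζ Q| ≤ X ^ (-ν)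

theorem HasUniformApprox.mono {n : ℕ} {ζ ν μ : ℝ} (h : HasUniformApprox n ζ ν) (hμ : μ ≤ ν) :
    HasUniformApprox n ζ μ := by
  obtain ⟨X₀, h1, h⟩ := h
  refine ⟨X₀, h1, fun X hX => ?_⟩
  obtain ⟨Q, h0, hd, hs, hv⟩ := h X hX
  exact ⟨Q, h0, hd, hs,
    hv.trans (Real.rpow_le_rpow_of_exponent_le (h1.trans hX) (neg_le_neg hμ))⟩

theorem one_le_abs_aeval_of_natDegree_eq_zero (ζ : ℝ) {P : ℤ[X]} (hP : P ≠ 0)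
    (h : P.natDegree = 0) : 1 ≤ |aeval ζ P| := by
  obtain ⟨a, rfl⟩ := natDegree_eq_zero.1 h
  rw [aeval_C]
  simpa using! (by exact_mod_cast Int.one_le_abs (C_ne_zero.1 hP) : (1 : ℝ) ≤ |(a : ℝ)|)

/-- Irreducible polynomials of degree less than `n` cannot be very small at `ζ` if
the uniform exponent exceeds `2 * n - 2`. -/
theorem exists_le_abs_aeval_of_natDegree_lt {n : ℕ} (hn : 2 ≤ n) {ζ ν : ℝ}
    (hζ : Transcendental ℤ ζ) (hν : 2 * (n : ℝ) - 2 < ν) (hU : HasUniformApprox n ζ ν) :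
    ∃ c : ℝ, 0 < c ∧ ∀ P : ℤ[X], Prime P → 1 ≤ P.natDegree → P.natDegree < n →
      c ≤ |aeval ζ P| * P.supNorm ^ (2 * n - 2) := by
  obtain ⟨X₀, hX₀, hU⟩ := hU
  set A : ℝ := (2 * n).factorial * (n * max 1 |ζ| ^ n) with hA
  -- One more than the constant of `supNorm_le_of_dvd`, so that a nonzero polynomial of height at
  -- most `H / K` cannot be a multiple of `P`.
  set K : ℝ := 2 ^ n * (n + 1) + 1 with hK
  have hn0 : (0 : ℝ) < n := by exact_mod_cast (by omega : 0 < n)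
  have hA0 : 0 < A := by positivity
  have hK1 : 1 ≤ K := by
    rw [hK]
    have : (0 : ℝ) ≤ 2 ^ n * (n + 1) := by positivity
    linarith
  have hK0 : 0 < K := one_pos.trans_le hK1
  have hlim : Tendsto (fun H : ℝ => A * K ^ ν * H ^ (-(ν - (2 * n - 2)))) atTop (nhds 0) := by
    simpa using (tendsto_rpow_neg_atTop (sub_pos.2 hν)).const_mul (A * K ^ ν)
  obtain ⟨B, hB⟩ := eventually_atTop.1 (hlim.eventually_le_const (show (0 : ℝ) < 1 / 2 by norm_num))
  obtain ⟨c, hc, hcP⟩ := exists_pos_le_abs_aeval hζ n (max B (K * X₀))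
  refine ⟨min c (1 / (2 * A)), by positivity, fun P hP h1 hPn => ?_⟩
  have hH1 := one_le_supNorm hP.ne_zero
  set H := P.supNorm
  have hH0 : 0 < H := one_pos.trans_le hH1
  rcases le_total H (max B (K * X₀)) with hle | hge
  · refine (min_le_left _ _).trans ((hcP P hP.ne_zero hPn.le hle).trans ?_)
    exact le_mul_of_one_le_right (abs_nonneg _) (one_le_pow₀ hH1)
  · refine (min_le_right _ _).trans ?_
    obtain ⟨Q, hQ0, hQn, hQX, hQv⟩ := hU (H / K)
      ((le_div_iff₀' hK0).2 ((le_max_right _ _).trans hge))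
    have hPQ : ¬ P ∣ Q := by
      intro hd
      have h2 := supNorm_le_of_dvd hQ0 hQn hd
      have h3 : H ≤ (K - 1) * (H / K) := by
        refine h2.trans ?_
        rw [hK, add_sub_cancel_right]
        gcongr
      have h4 : (K - 1) * (H / K) = H - H / K := by field_simp
      have h5 : 0 < H / K := by positivity
      linarith
    have key := one_le_of_prime_of_not_dvd h1 hPn.le ζ hP rfl hQn hPQ
      (hQX.trans (div_le_self hH0.le hK1))
    -- Both powers in Liouville's inequality have exponent `n + deg P - 1`, at most `2n - 2` because
    -- `deg P < n`.
    have hp1 : H ^ (n - 1) * H ^ P.natDegree ≤ H ^ (2 * n - 2) := by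
      rw [← pow_add]
      exact pow_le_pow_right₀ hH1 (by omega)
    have hp2 : H ^ n * H ^ (P.natDegree - 1) ≤ H ^ (2 * n - 2) := by
      rw [← pow_add]
      exact pow_le_pow_right₀ hH1 (by omega)
    have hsmall : A * (H ^ (2 * n - 2) * (H / K) ^ (-ν)) ≤ 1 / 2 := by
      refine le_of_eq_of_le ?_ (hB H ((le_max_left _ _).trans hge))
      have e1 : (H / K) ^ (-ν) = H ^ (-ν) * K ^ ν := by
        rw [Real.div_rpow hH0.le hK0.le, Real.rpow_neg hK0.le, div_inv_eq_mul]
      have e2 : H ^ (-(ν - (2 * n - 2))) = H ^ (2 * n - 2) * H ^ (-ν) := by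
        rw [← Real.rpow_natCast H, ← Real.rpow_add hH0, Nat.cast_sub (by omega)]
        push_cast
        congr 1
        ring
      rw [e1, e2]
      ring
    have : 1 ≤ A * (H ^ (2 * n - 2) * |aeval ζ P|) + 1 / 2 := by
      calc (1 : ℝ) ≤ _ := key
        _ ≤ A * (H ^ (2 * n - 2) * |aeval ζ P| + H ^ (2 * n - 2) * (H / K) ^ (-ν)) := by
            gcongr
        _ ≤ _ := by rw [mul_add]; gcongr
    rw [div_le_iff₀ (by positivity)]
    linarith

/-- Irreducible polynomials of degree `n` cannot be very small at `ζ` if the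
uniform exponent is large. -/
theorem exists_le_abs_aeval_of_natDegree_eq {n : ℕ} (hn : 2 ≤ n) {ζ ν : ℝ}
    (hζ : Transcendental ℤ ζ) (hν : 2 * (n : ℝ) - 2 < ν) (hν' : ν ≤ 2 * n - 1)
    (hU : HasUniformApprox n ζ ν) :
    ∃ c : ℝ, 0 < c ∧ ∀ P : ℤ[X], Prime P → P.natDegree = n →
      c ≤ |aeval ζ P| * P.supNorm ^ (ν * ((n - 1) / (ν - n))) := by
  obtain ⟨X₀, hX₀, hU⟩ := hU
  set A : ℝ := (2 * n).factorial * (n * max 1 |ζ| ^ n) with hA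
  have hn2 : (2 : ℝ) ≤ n := by exact_mod_cast hn
  have hn0 : (0 : ℝ) < n := by linarith
  have hA1 : 1 ≤ A := by
    have h1 : (1 : ℝ) ≤ (2 * n).factorial := by exact_mod_cast Nat.factorial_pos _
    have h2 : (1 : ℝ) ≤ max 1 |ζ| ^ n := one_le_pow₀ (le_max_left _ _)
    have h3 : (1 : ℝ) ≤ n := by linarith
    exact one_le_mul_of_one_le_of_one_le h1 (one_le_mul_of_one_le_of_one_le h3 h2)
  set c₁ : ℝ := 1 / (2 * A) with hc₁
  have hc₁0 : 0 < c₁ := by positivity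
  have hc₁1 : c₁ ≤ 1 := by
    rw [hc₁, div_le_one (by positivity)]
    linarith
  have hνn : 0 < ν - n := by linarith
  set x : ℝ := (n - 1) / (ν - n) with hx
  have hx0 : 0 ≤ x := div_nonneg (by linarith) hνn.le
  -- This identity turns a bound `Y ≪ H ^ x` into the exponent `ν * x` of the claim.
  have hxw : n * x + (n - 1) = ν * x := by
    rw [hx]
    field_simp
    ring
  set D : ℝ := max X₀ (c₁⁻¹ ^ (1 / (ν - n))) with hD
  have hDl : X₀ ≤ D := le_max_left _ _
  have hDr : c₁⁻¹ ^ (1 / (ν - n)) ≤ D := le_max_right _ _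
  have hD0 : 0 < D := one_pos.trans_le (hX₀.trans hDl)
  refine ⟨c₁ / D ^ n, by positivity, fun P hP hPn => ?_⟩
  have hH1 := one_le_supNorm hP.ne_zero
  have hδ := abs_aeval_pos hζ hP.ne_zero
  set H := P.supNorm with hHdef
  set δ := |aeval ζ P| with hδdef
  have hH0 : 0 < H := one_pos.trans_le hH1
  -- `Y` is the height at which the `P` term of Liouville's inequality equals `A * c₁ = 1 / 2`; the
  -- `Q` term must then supply the other half.
  set Y : ℝ := (c₁ / (H ^ (n - 1) * δ)) ^ (1 / (n : ℝ)) with hYdef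
  have hY0 : 0 < Y := by positivity
  have hYn : Y ^ n = c₁ / (H ^ (n - 1) * δ) := by
    rw [hYdef, ← Real.rpow_natCast, ← Real.rpow_mul (by positivity), one_div_mul_cancel hn0.ne',
      Real.rpow_one]
  have hYn' : H ^ (n - 1) * Y ^ n * δ = c₁ := by
    rw [hYn]
    field_simp
  clear_value A c₁ x D H δ Y
  have hHx1 : 1 ≤ H ^ x := Real.one_le_rpow hH1 hx0
  -- it suffices to bound `Y` from above
  suffices hYle : Y ≤ D * H ^ x by
    rw [div_le_iff₀ (by positivity), ← hxw]
    calc c₁ = H ^ (n - 1) * Y ^ n * δ := hYn'.symm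
      _ ≤ H ^ (n - 1) * (D * H ^ x) ^ n * δ := by gcongr
      _ = δ * H ^ (n * x + (n - 1)) * D ^ n := by
          rw [Real.rpow_add hH0, mul_pow, ← Real.rpow_natCast (H ^ x), ← Real.rpow_mul hH0.le,
            mul_comm x, ← Real.rpow_natCast H (n - 1), Nat.cast_sub (by omega), Nat.cast_one]
          ring
  rcases le_total Y X₀ with hle | hge
  · exact (hle.trans hDl).trans (le_mul_of_one_le_right (by positivity) hHx1)
  have hY1 : 1 ≤ Y := hX₀.trans hge
  refine le_trans ?_ (mul_le_mul_of_nonneg_right hDr (by positivity))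
  obtain ⟨Q, hQ0, hQn, hQX, hQv⟩ := hU Y hge
  -- Since `deg P = n`, a multiple `Q` of `P` is a constant multiple, so `P` itself is as small as
  -- `Y ^ (-ν)`. Otherwise Liouville's inequality applies.
  by_cases hPQ : P ∣ Q
  · obtain ⟨R, rfl⟩ := hPQ
    have hR0 : R ≠ 0 := right_ne_zero_of_mul hQ0
    have hRd : R.natDegree = 0 := by
      rw [natDegree_mul hP.ne_zero hR0] at hQn
      omega
    have hδQ : δ ≤ Y ^ (-ν) := by
      refine le_trans ?_ hQv
      rw [map_mul, abs_mul, ← hδdef]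
      exact le_mul_of_one_le_right hδ.le (one_le_abs_aeval_of_natDegree_eq_zero ζ hR0 hRd)
    have h1 : c₁ * Y ^ (ν - n) ≤ H ^ (n - 1) := by
      calc c₁ * Y ^ (ν - n) = H ^ (n - 1) * Y ^ n * δ * Y ^ (ν - n) := by rw [hYn']
        _ ≤ H ^ (n - 1) * Y ^ n * Y ^ (-ν) * Y ^ (ν - n) := by gcongr
        _ = H ^ (n - 1) * (Y ^ (n : ℝ) * Y ^ (-ν) * Y ^ (ν - n)) := by
            rw [Real.rpow_natCast]; ring
        _ = H ^ (n - 1) := by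
            rw [← Real.rpow_add hY0, ← Real.rpow_add hY0,
              show (n : ℝ) + -ν + (ν - n) = 0 by ring, Real.rpow_zero, mul_one]
    have h2 : Y ^ (ν - n) ≤ c₁⁻¹ * H ^ ((n : ℝ) - 1) := by
      rw [← Nat.cast_one, ← Nat.cast_sub (by omega), Real.rpow_natCast, inv_mul_eq_div,
        le_div_iff₀' hc₁0]
      exact h1
    have h3 := Real.rpow_le_rpow (by positivity) h2 (one_div_pos.2 hνn).le
    rwa [← Real.rpow_mul hY0.le, mul_one_div_cancel hνn.ne', Real.rpow_one,
      Real.mul_rpow (by positivity) (by positivity), ← Real.rpow_mul hH0.le, mul_one_div,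
      ← hx] at h3
  · have key := one_le_of_prime_of_not_dvd (by omega) le_rfl ζ hP hPn hQn hPQ hQX
    rw [← hA, ← hHdef, ← hδdef] at key
    have hνn1 : 0 < ν - n + 1 := by linarith
    have h1 : c₁ ≤ H ^ n * Y ^ (-(ν - n + 1)) := by
      have e : Y ^ (n - 1) * Y ^ (-ν) = Y ^ (-(ν - n + 1)) := by
        rw [← Real.rpow_natCast, ← Real.rpow_add hY0, Nat.cast_sub (by omega), Nat.cast_one]
        congr 1
        ring
      have h2 : 1 ≤ A * (c₁ + H ^ n * Y ^ (-(ν - n + 1))) := by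
        rw [← e, ← hYn', ← mul_assoc (H ^ n)]
        refine key.trans ?_
        gcongr
      have h3 : A * c₁ = 1 / 2 := by
        rw [hc₁]
        field_simp
      rw [mul_add, h3] at h2
      rw [hc₁, div_le_iff₀ (by positivity)]
      linarith
    have h2 : Y ^ (ν - n + 1) ≤ c₁⁻¹ * H ^ (n : ℝ) := by
      rw [Real.rpow_natCast, inv_mul_eq_div, le_div_iff₀ hc₁0]
      rw [Real.rpow_neg hY0.le, ← div_eq_mul_inv, le_div_iff₀ (by positivity)] at h1
      linarith
    have h3 := Real.rpow_le_rpow (by positivity) h2 (one_div_pos.2 hνn1).le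
    rw [← Real.rpow_mul hY0.le, mul_one_div_cancel hνn1.ne', Real.rpow_one,
      Real.mul_rpow (by positivity) (by positivity), ← Real.rpow_mul hH0.le, mul_one_div] at h3
    refine h3.trans ?_
    refine mul_le_mul ?_ ?_ (by positivity) (by positivity)
    · refine Real.rpow_le_rpow_of_exponent_le ((one_le_inv₀ hc₁0).2 hc₁1) ?_
      exact one_div_le_one_div_of_le hνn (by linarith)
    -- The comparison `n / (ν - n + 1) ≤ (n - 1) / (ν - n)` is equivalent to `ν ≤ 2n - 1`.
    · refine Real.rpow_le_rpow_of_exponent_le hH1 ?_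
      rw [hx, div_le_div_iff₀ hνn1 hνn]
      nlinarith

/-- A large uniform exponent bounds the ordinary exponent from above. -/
theorem exists_le_abs_aeval_mul_supNorm_rpow {n : ℕ} (hn : 2 ≤ n) {ζ ν : ℝ}
    (hζ : Transcendental ℤ ζ) (hν : 2 * (n : ℝ) - 2 < ν) (hν' : ν ≤ 2 * n - 1)
    (hU : HasUniformApprox n ζ ν) :
    ∃ c : ℝ, 0 < c ∧ ∀ P : ℤ[X], P ≠ 0 → P.natDegree ≤ n →
      c ≤ |aeval ζ P| * P.supNorm ^ (ν * ((n - 1) / (ν - n))) := by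
  obtain ⟨a, ha, haP⟩ := exists_le_abs_aeval_of_natDegree_lt hn hζ hν hU
  obtain ⟨b, hb, hbP⟩ := exists_le_abs_aeval_of_natDegree_eq hn hζ hν hν' hU
  have hn2 : (2 : ℝ) ≤ n := by exact_mod_cast hn
  have hνn : 0 < ν - n := by linarith
  set w : ℝ := ν * ((n - 1) / (ν - n)) with hw
  -- Hence the bound for degrees below `n` is absorbed into the one for degree `n`.
  have hww : 2 * (n : ℝ) - 2 ≤ w := by
    rw [hw, mul_div_assoc', le_div_iff₀ hνn]
    nlinarith
  have hw0 : 0 ≤ w := by linarith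
  set c : ℝ := min 1 (min a b / (2 ^ n) ^ w) with hc
  have hc0 : 0 < c := by positivity
  have hprime : ∀ P : ℤ[X], Prime P → 1 ≤ P.natDegree → P.natDegree ≤ n →
      c ≤ |aeval ζ P| * intMahlerMeasure P ^ w := by
    intro P hP h1 h2
    have hH1 := one_le_supNorm hP.ne_zero
    have hab : min a b ≤ |aeval ζ P| * P.supNorm ^ w := by
      rcases h2.lt_or_eq with h2 | h2
      · refine (min_le_left _ _).trans ((haP P hP h1 h2).trans ?_)
        gcongr
        rw [← Real.rpow_natCast, Nat.cast_sub (by omega)]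
        push_cast
        exact Real.rpow_le_rpow_of_exponent_le hH1 hww
      · exact (min_le_right _ _).trans (hbP P hP h2)
    refine (min_le_right _ _).trans ?_
    rw [div_le_iff₀ (by positivity)]
    have hM := one_le_intMahlerMeasure hP.ne_zero
    calc min a b ≤ _ := hab
      _ ≤ |aeval ζ P| * (2 ^ n * intMahlerMeasure P) ^ w := by
          gcongr
          exact supNorm_le_intMahlerMeasure h2
      _ = _ := by
          rw [Real.mul_rpow (by positivity) (by positivity)]
          ring
  -- Each prime factor of positive degree costs a factor `c ≤ 1`, and constants cost nothing; the
  -- exponent `natDegree` makes the loss multiplicative and at worst `c ^ n`.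
  have hall : ∀ P : ℤ[X], P ≠ 0 → P.natDegree ≤ n →
      c ^ P.natDegree ≤ |aeval ζ P| * intMahlerMeasure P ^ w := by
    intro P
    have hconst : ∀ P : ℤ[X], P ≠ 0 → P.natDegree = 0 →
        1 ≤ |aeval ζ P| * intMahlerMeasure P ^ w := fun P h0 hd =>
      one_le_mul_of_one_le_of_one_le (one_le_abs_aeval_of_natDegree_eq_zero ζ h0 hd)
        (Real.one_le_rpow (one_le_intMahlerMeasure h0) hw0)
    induction P using UniqueFactorizationMonoid.induction_on_prime with
    | h₁ => exact fun h => (h rfl).elim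
    | h₂ P hP =>
      intro h0 _
      rw [natDegree_eq_zero_of_isUnit hP, pow_zero]
      exact hconst P h0 (natDegree_eq_zero_of_isUnit hP)
    | h₃ R P hR hP ih =>
      intro h0 hd
      rw [natDegree_mul hP.ne_zero hR] at hd ⊢
      have hR' := ih hR (by omega)
      have hM := one_le_intMahlerMeasure hP.ne_zero
      have hM' := one_le_intMahlerMeasure hR
      rw [intMahlerMeasure_mul, Real.mul_rpow (by positivity) (by positivity), map_mul, abs_mul,
        mul_mul_mul_comm, pow_add]
      refine mul_le_mul ?_ hR' (by positivity) (by positivity)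
      rcases Nat.eq_zero_or_pos P.natDegree with h | h
      · rw [h, pow_zero]
        exact hconst P hP.ne_zero h
      · exact (pow_le_of_le_one hc0.le (min_le_left _ _) h.ne').trans (hprime P hP h (by omega))
  refine ⟨c ^ n / ((n : ℝ) + 1) ^ w, by positivity, fun P hP hd => ?_⟩
  have hH1 := one_le_supNorm hP
  rw [div_le_iff₀ (by positivity)]
  calc c ^ n ≤ c ^ P.natDegree := pow_le_pow_of_le_one hc0.le (min_le_left _ _) hd
    _ ≤ _ := hall P hP hd
    _ ≤ |aeval ζ P| * ((n + 1) * P.supNorm) ^ w := by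
        have hM := one_le_intMahlerMeasure hP
        gcongr
        exact intMahlerMeasure_le_supNorm hd
    _ = _ := by
        rw [Real.mul_rpow (by positivity) (by positivity)]
        ring

/-! ### Best approximations and independent blocks -/

/-- Among polynomials of height at most `H(Q)` smaller than `P k` at `ζ`, one of least height is
itself a best approximation. It occurs later in the sequence, so its height is at least that of `P
(k + 1)`. -/
theorem IsBestApproxSeq.abs_aeval_le {n : ℕ} {ζ : ℝ} {P : ℕ → ℤ[X]} (hP : IsBestApproxSeq n ζ P)
    {k : ℕ} {Q : ℤ[X]} (hQ : Q ≠ 0) (hQn : Q.natDegree ≤ n)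
    (hlt : Q.supNorm < (P (k + 1)).supNorm) : |aeval ζ (P k)| ≤ |aeval ζ Q| := by
  by_contra! hv
  obtain ⟨R, ⟨⟨hRn, hRh⟩, hR0, hRv⟩, hmin⟩ := Set.exists_min_image
    ({R : ℤ[X] | R.natDegree ≤ n ∧ R.supNorm ≤ Q.supNorm} ∩
      {R | R ≠ 0 ∧ |aeval ζ R| < |aeval ζ (P k)|})
    (fun R => R.supNorm) ((finite_natDegree_le_supNorm_le n _).inter_of_left _)
    ⟨Q, ⟨hQn, le_rfl⟩, hQ, hv⟩
  have hbest : IsBestApprox n ζ R := ⟨hR0, hRn, fun S hS0 hSn hS hSv =>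
    not_le.2 hS (hmin S ⟨⟨hSn, hS.le.trans hRh⟩, hS0, hSv.trans hRv⟩)⟩
  obtain ⟨j, hj⟩ := hP.exhaustive R hbest
  have hval : |aeval ζ R| = |aeval ζ (P j)| := by
    rcases hj with rfl | rfl <;> simp
  have hnorm : R.supNorm = (P j).supNorm := by
    rcases hj with rfl | rfl
    · rfl
    · simp [supNorm_eq_iSup]
  have hkj : k < j := hP.strictAnti.lt_iff_gt.1 (hval ▸ hRv)
  have := hP.monotone (Nat.succ_le_of_lt hkj)
  simp only [Nat.succ_eq_add_one] at this
  linarith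

theorem IsBestApproxSeq.tendsto_supNorm {n : ℕ} {ζ : ℝ} {P : ℕ → ℤ[X]}
    (hP : IsBestApproxSeq n ζ P) : Tendsto (fun k => (P k).supNorm) atTop atTop := by
  refine tendsto_atTop_atTop_of_monotone hP.monotone fun B => ?_
  by_contra! h
  refine Set.infinite_range_of_injective
    (fun k l hkl => hP.strictAnti.injective (congrArg (fun Q : ℤ[X] => |aeval ζ Q|) hkl) :
      Function.Injective P) ((finite_natDegree_le_supNorm_le n B).subset ?_)
  rintro _ ⟨k, rfl⟩
  exact ⟨(hP.best k).2.1, (h k).le⟩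

/-- If `n + 1` successive best approximations are independent, then the first of them is
not too small. -/
theorem IsBestApproxSeq.one_le_of_linearIndependent {n : ℕ} {ζ : ℝ} {P : ℕ → ℤ[X]}
    (hP : IsBestApproxSeq n ζ P) {k : ℕ}
    (hk : LinearIndependent ℝ fun i j : Fin (n + 1) => ((P (k + i)).coeff j : ℝ)) :
    1 ≤ ((n + 1).factorial * (n + 1) : ℝ) *
      (|aeval ζ (P k)| * ∏ i ∈ Finset.range n, (P (k + 1 + i)).supNorm) := by
  have hdet : (Matrix.of fun i j : Fin (n + 1) => (P (k + i)).coeff j).det ≠ 0 := by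
    intro h0
    have h1 : IsUnit (Matrix.of fun i j : Fin (n + 1) => ((P (k + i)).coeff j : ℝ)) :=
      Matrix.linearIndependent_rows_iff_isUnit.1 hk
    have h2 := ((Matrix.isUnit_iff_isUnit_det _).1 h1).ne_zero
    apply h2
    have h3 := Int.cast_det (R := ℝ) (Matrix.of fun i j : Fin (n + 1) => (P (k + i)).coeff j)
    rw [h0, Int.cast_zero] at h3
    exact h3.symm
  have key := one_le_sum_abs_aeval_div_supNorm n ζ (fun i => P (k + i))
    (fun i => (hP.best _).2.1) hdet
  have hH : ∀ j, 0 < (P j).supNorm := fun j => one_pos.trans_le (one_le_supNorm (hP.best j).1)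
  refine key.trans ?_
  -- The first polynomial of the block has both the largest value and the smallest height.
  have hsum : ∑ i : Fin (n + 1), |aeval ζ (P (k + i))| / (P (k + i)).supNorm ≤
      (n + 1) * (|aeval ζ (P k)| / (P k).supNorm) := by
    refine (Finset.sum_le_card_nsmul _ _ (|aeval ζ (P k)| / (P k).supNorm) fun i _ => ?_).trans
      (by simp)
    exact div_le_div₀ (abs_nonneg _) (hP.strictAnti.antitone (Nat.le_add_right k i)) (hH k)
      (hP.monotone (Nat.le_add_right k i))
  have hprod : ∏ i : Fin (n + 1), (P (k + i)).supNorm =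
      (P k).supNorm * ∏ i ∈ Finset.range n, (P (k + 1 + i)).supNorm := by
    rw [← Finset.prod_range fun i => (P (k + i)).supNorm, Finset.prod_range_succ', mul_comm]
    simp only [add_zero, add_assoc, add_comm 1]
  rw [hprod]
  have hn : 0 ≤ ∏ i ∈ Finset.range n, (P (k + 1 + i)).supNorm :=
    Finset.prod_nonneg fun i _ => supNorm_nonneg _
  have hk0 := hH k
  calc _ ≤ ((n + 1).factorial : ℝ) * ((n + 1) * (|aeval ζ (P k)| / (P k).supNorm) *
        ((P k).supNorm * ∏ i ∈ Finset.range n, (P (k + 1 + i)).supNorm)) := by gcongr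
    _ = _ := by field_simp

/-- A sequence with `H (k + 1) ≤ E * H k ^ x` satisfies the corresponding bound for products
of successive terms. -/
theorem exists_prod_le_rpow {H : ℕ → ℝ} (hH : ∀ k, 0 < H k) {E x : ℝ} (hE : 0 < E) (hx : 0 ≤ x)
    {k₀ : ℕ} (hstep : ∀ k, k₀ ≤ k → H (k + 1) ≤ E * H k ^ x) (m : ℕ) :
    ∃ G : ℝ, 0 < G ∧ ∀ k, k₀ ≤ k →
      ∏ i ∈ Finset.range m, H (k + i) ≤ G * H k ^ ∑ i ∈ Finset.range m, x ^ i := by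
  have hterm : ∀ m : ℕ, ∃ G : ℝ, 0 < G ∧ ∀ k, k₀ ≤ k → H (k + m) ≤ G * H k ^ (x ^ m) := by
    intro m
    induction m with
    | zero => exact ⟨1, one_pos, fun k _ => by simp⟩
    | succ m ih =>
      obtain ⟨G, hG, ih⟩ := ih
      refine ⟨E * G ^ x, by positivity, fun k hk => ?_⟩
      have hk0 := hH k
      calc H (k + m + 1) ≤ E * H (k + m) ^ x := hstep _ (by omega)
        _ ≤ E * (G * H k ^ (x ^ m)) ^ x := by
            have := ih k hk
            have := (hH (k + m)).le
            gcongr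
        _ = _ := by
            rw [Real.mul_rpow hG.le (by positivity), ← Real.rpow_mul hk0.le, pow_succ, mul_assoc]
  induction m with
  | zero => exact ⟨1, one_pos, fun k _ => by simp⟩
  | succ m ih =>
    obtain ⟨G, hG, ih⟩ := ih
    obtain ⟨G', hG', hm⟩ := hterm m
    refine ⟨G * G', by positivity, fun k hk => ?_⟩
    have hk0 := hH k
    rw [Finset.prod_range_succ, Finset.sum_range_succ, Real.rpow_add hk0, mul_mul_mul_comm]
    exact mul_le_mul (ih k hk) (hm k hk) (hH _).le (by positivity)

/-- The bound for the uniform exponent when infinitely many blocks of `n + 1` successive best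
approximations are independent. -/
theorem HasUniformApprox.le_geom_sum {n : ℕ} (hn : 2 ≤ n) {ζ ν : ℝ} (hζ : Transcendental ℤ ζ)
    (hν : 2 * (n : ℝ) - 2 < ν) (hν' : ν ≤ 2 * n - 1) (hU : HasUniformApprox n ζ ν)
    {P : ℕ → ℤ[X]} (hP : IsBestApproxSeq n ζ P)
    (hinf : {k : ℕ | LinearIndependent ℝ fun i j : Fin (n + 1) =>
      ((P (k + i)).coeff j : ℝ)}.Infinite) :
    ν ≤ ∑ i ∈ Finset.range n, ((n - 1) / (ν - n)) ^ i := by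
  obtain ⟨c, hc, hcP⟩ := exists_le_abs_aeval_mul_supNorm_rpow hn hζ hν hν' hU
  obtain ⟨X₀, hX₀, hU⟩ := hU
  have hn2 : (2 : ℝ) ≤ n := by exact_mod_cast hn
  have hν0 : 0 < ν := by linarith
  set x : ℝ := (n - 1) / (ν - n) with hx
  have hx0 : 0 ≤ x := div_nonneg (by linarith) (by linarith)
  set S := ∑ i ∈ Finset.range n, x ^ i
  have hH1 : ∀ j, 1 ≤ (P j).supNorm := fun j => one_le_supNorm (hP.best j).1
  have hH : ∀ j, 0 < (P j).supNorm := fun j => one_pos.trans_le (hH1 j)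
  obtain ⟨k₀, hk₀⟩ := eventually_atTop.1 (hP.tendsto_supNorm.eventually_ge_atTop (2 * X₀))
  have hL : ∀ k, k₀ ≤ k → |aeval ζ (P k)| ≤ 2 ^ ν * (P (k + 1)).supNorm ^ (-ν) := by
    intro k hk
    have h0 := hH (k + 1)
    have h1 := hk₀ (k + 1) (by omega)
    -- Halving makes the height of `Q` strictly smaller than that of `P (k + 1)`, at the cost of the
    -- factor `2 ^ ν`.
    obtain ⟨Q, hQ0, hQn, hQX, hQv⟩ := hU ((P (k + 1)).supNorm / 2) (by linarith)
    refine (hP.abs_aeval_le hQ0 hQn (by linarith)).trans (hQv.trans_eq ?_)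
    rw [Real.div_rpow h0.le (by norm_num), Real.rpow_neg (by norm_num : (0 : ℝ) ≤ 2),
      div_inv_eq_mul, mul_comm]
  have hstep : ∀ k, k₀ ≤ k →
      (P (k + 1)).supNorm ≤ (2 ^ ν / c) ^ (1 / ν) * (P k).supNorm ^ x := by
    intro k hk
    have h0 := hH (k + 1)
    have h0' := hH k
    have h1 : c ≤ 2 ^ ν * (P (k + 1)).supNorm ^ (-ν) * (P k).supNorm ^ (ν * x) :=
      (hcP _ (hP.best k).1 (hP.best k).2.1).trans (by have := hL k hk; gcongr)
    have h2 : (P (k + 1)).supNorm ^ ν ≤ 2 ^ ν / c * (P k).supNorm ^ (ν * x) := by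
      rw [Real.rpow_neg h0.le] at h1
      have h3 : 0 < (P (k + 1)).supNorm ^ ν := by positivity
      rw [div_mul_eq_mul_div, le_div_iff₀ hc]
      calc _ ≤ (P (k + 1)).supNorm ^ ν *
            (2 ^ ν * ((P (k + 1)).supNorm ^ ν)⁻¹ * (P k).supNorm ^ (ν * x)) := by gcongr
        _ = _ := by field_simp
    have h3 := Real.rpow_le_rpow (by positivity) h2 (one_div_pos.2 hν0).le
    rwa [← Real.rpow_mul h0.le, mul_one_div_cancel hν0.ne', Real.rpow_one,
      Real.mul_rpow (by positivity) (by positivity), ← Real.rpow_mul h0'.le,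
      show ν * x * (1 / ν) = x by field_simp] at h3
  obtain ⟨G, hG, hprod⟩ := exists_prod_le_rpow hH (by positivity) hx0 hstep n
  by_contra! hlt
  set A : ℝ := (n + 1).factorial * (n + 1) * 2 ^ ν * G with hA
  -- `A` collects the constants of the determinant estimate; if `S < ν`, its upper bound would tend
  -- to `0`, yet it is at least `1` infinitely often.
  have hlim : Tendsto (fun k => A * (P (k + 1)).supNorm ^ (-(ν - S))) atTop (nhds 0) := by
    simpa using (((tendsto_rpow_neg_atTop (sub_pos.2 hlt)).comp
      (hP.tendsto_supNorm.comp (tendsto_add_atTop_nat 1))).const_mul A)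
  obtain ⟨k₁, hk₁⟩ := eventually_atTop.1 (hlim.eventually_lt_const one_pos)
  obtain ⟨k, hk, hkk⟩ := hinf.exists_gt (max k₀ k₁)
  have hkk₀ : k₀ ≤ k := (le_max_left _ _).trans hkk.le
  have h0 := hH (k + 1)
  refine absurd (hk₁ k ((le_max_right _ _).trans hkk.le)) (not_lt.2 ?_)
  calc (1 : ℝ) ≤ _ := hP.one_le_of_linearIndependent hk
    _ ≤ ((n + 1).factorial * (n + 1) : ℝ) * ((2 ^ ν * (P (k + 1)).supNorm ^ (-ν)) *
          (G * (P (k + 1)).supNorm ^ S)) := by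
        have h1 := hL k hkk₀
        have h2 := hprod (k + 1) (by omega)
        have h3 : 0 ≤ ∏ i ∈ Finset.range n, (P (k + 1 + i)).supNorm :=
          Finset.prod_nonneg fun i _ => supNorm_nonneg _
        gcongr
    _ = A * (P (k + 1)).supNorm ^ (-(ν - S)) := by
        rw [show -(ν - S) = -ν + S by ring, Real.rpow_add h0, hA]
        ring

/-! ### Asymptotics of the geometric sum -/

theorem eventually_geom_sum_lt {s : ℝ} (hs0 : 0 < s) (hs : s < Real.log 2) :
    ∀ᶠ n : ℕ in atTop, ∑ i ∈ Finset.range n,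
      (((n : ℝ) - 1) / (2 * n - 1 - s - n)) ^ i < 2 * n - 1 - s := by
  have hs1 : s < 1 := hs.trans (Real.log_two_lt_d9.trans (by norm_num))
  have hexp : Real.exp s < 2 := (Real.lt_log_iff_exp_lt two_pos).1 hs
  obtain ⟨r, hr1, hr2⟩ := exists_between hexp
  have hlim : Tendsto (fun N : ℕ => ((1 + -s / (N : ℝ)) ^ N)⁻¹) atTop (nhds (Real.exp s)) := by
    have := (Real.tendsto_one_add_div_pow_exp (-s)).inv₀ (Real.exp_pos _).ne'
    rwa [← Real.exp_neg, neg_neg] at this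
  -- This gives `N * (2 - r) ≥ 2`, enough for `(N + 1) * r < 2 * (N + 1) - 1 - s` since `r < 2` and
  -- `s < 1`.
  have hlarge : ∀ᶠ N : ℕ in atTop, 2 / (2 - r) ≤ (N : ℝ) :=
    tendsto_natCast_atTop_atTop.eventually_ge_atTop _
  have key : ∀ᶠ N : ℕ in atTop, ∑ i ∈ Finset.range (N + 1),
      ((((N + 1 : ℕ) : ℝ) - 1) / (2 * ((N + 1 : ℕ) : ℝ) - 1 - s - ((N + 1 : ℕ) : ℝ))) ^ i <
        2 * ((N + 1 : ℕ) : ℝ) - 1 - s := by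
    filter_upwards [hlim.eventually_lt_const hr1, hlarge, eventually_ge_atTop 1] with N h1 h2 h3
    have hN : (1 : ℝ) ≤ N := by exact_mod_cast h3
    push_cast
    -- With `N = n - 1` the ratio is `(1 - s / N)⁻¹`; it is at least `1`, so its `N`-th power, with
    -- limit `e ^ s`, dominates all the terms.
    have hx : ((N : ℝ) + 1 - 1) / (2 * (N + 1) - 1 - s - (N + 1)) = (1 + -s / N)⁻¹ := by
      have : (N : ℝ) - s ≠ 0 := by linarith
      rw [show 2 * ((N : ℝ) + 1) - 1 - s - (N + 1) = N - s by ring, add_sub_cancel_right,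
        ← one_div, one_add_div (by positivity), one_div_div, sub_eq_add_neg]
    rw [hx]
    have hx1 : 1 ≤ (1 + -s / (N : ℝ))⁻¹ := by
      have h4 : s / N < 1 := by rw [div_lt_one (by positivity)]; linarith
      have h5 : 0 < s / N := by positivity
      rw [neg_div]
      exact (one_le_inv₀ (by linarith)).2 (by linarith)
    rw [← inv_pow] at h1
    have hr : 2 ≤ N * (2 - r) := by rwa [div_le_iff₀ (by linarith)] at h2
    calc _ ≤ ∑ _i ∈ Finset.range (N + 1), r := by
          refine Finset.sum_le_sum fun i hi => ?_
          exact (pow_le_pow_right₀ hx1 (Finset.mem_range_succ_iff.1 hi)).trans h1.le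
      _ = (N + 1) * r := by simp
      _ < _ := by nlinarith
  obtain ⟨N, hN⟩ := eventually_atTop.1 key
  refine eventually_atTop.2 ⟨N + 1, fun n hn => ?_⟩
  obtain ⟨k, rfl⟩ : ∃ k, n = k + 1 := ⟨n - 1, by omega⟩
  exact hN k (by omega)

/-! ### Passage to polynomials and conclusion -/

theorem hasUniformApprox_of_eventually {n : ℕ} {ζ ν : ℝ}
    (h : ∀ᶠ X : ℝ in atTop, ∃ (x : ℤ) (y : Fin n → ℤ), (x ≠ 0 ∨ y ≠ 0) ∧ |(x : ℝ)| ≤ X ∧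
      (∀ i, |(y i : ℝ)| ≤ X) ∧
      |(x : ℝ) + ∑ i : Fin n, ζ ^ ((i : ℕ) + 1) * (y i : ℝ)| ≤ X ^ (-ν)) :
    HasUniformApprox n ζ ν := by
  obtain ⟨X₁, h⟩ := eventually_atTop.1 h
  refine ⟨max 1 X₁, le_max_left _ _, fun Y hY => ?_⟩
  obtain ⟨x, y, hxy, hx, hy, hv⟩ := h Y ((le_max_right _ _).trans hY)
  set a : Fin (n + 1) → ℤ := Fin.cons x y with ha
  have hcoeff : ∀ i : Fin (n + 1), (∑ i, C (a i) * X ^ (i : ℕ)).coeff i = a i := by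
    intro i
    simp [finsetSum_coeff, coeff_X_pow, Fin.val_inj]
  have hdeg : (∑ i, C (a i) * X ^ (i : ℕ)).degree < ((n + 1 : ℕ) : WithBot ℕ) :=
    degree_sum_fin_lt a
  refine ⟨∑ i, C (a i) * X ^ (i : ℕ), fun h0 => ?_, ?_, ?_, ?_⟩
  · have ha0 : ∀ i, a i = 0 := fun i => by rw [← hcoeff, h0, coeff_zero]
    rcases hxy with hx | hy
    · exact hx (ha0 0)
    · exact hy (funext fun i => ha0 i.succ)
  · exact natDegree_le_iff_coeff_eq_zero.2 fun k hk =>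
      coeff_eq_zero_of_degree_lt (hdeg.trans_le (by exact_mod_cast hk))
  · obtain ⟨i, hi⟩ := (∑ i, C (a i) * X ^ (i : ℕ)).exists_eq_supNorm
    rw [hi]
    by_cases hin : i < n + 1
    · rw [hcoeff ⟨i, hin⟩, Int.norm_eq_abs]
      refine Fin.cases ?_ (fun j => ?_) (⟨i, hin⟩ : Fin (n + 1))
      · exact hx
      · exact hy j
    · rw [coeff_eq_zero_of_degree_lt (hdeg.trans_le (by exact_mod_cast not_lt.1 hin)), norm_zero]
      exact zero_le_one.trans ((le_max_left _ _).trans hY)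
  · convert hv using 2
    rw [map_sum, Fin.sum_univ_succ]
    simp [ha, mul_comm]

theorem theorem4p4 (hconj : BestApproxConjecture) :
    ∀ ε : ℝ, 0 < ε → ∃ n₀ : ℕ, ∀ n : ℕ, n₀ ≤ n → ∀ ζ : ℝ, Transcendental ℤ ζ →
      wHat n ζ ≤ ((2 * (n : ℝ) - 1 - Real.log 2 + ε : ℝ) : EReal) := by
  intro ε hε
  have hlog : 1 / 2 < Real.log 2 := lt_trans (by norm_num) Real.log_two_gt_d9
  have hlog' : Real.log 2 < 1 := Real.log_two_lt_d9.trans (by norm_num)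
  -- Capping `ε` at `1 / 2` keeps `0 < s < log 2 < 1`, so that `2n - 1 - s` lies in the range `(2n -
  -- 2, 2n - 1]` required by `le_geom_sum`.
  set s : ℝ := Real.log 2 - min ε (1 / 2) with hs
  have hmin : 0 < min ε (1 / 2) := by positivity
  have hs0 : 0 < s := by linarith [min_le_right ε (1 / 2)]
  obtain ⟨n₀, hn₀⟩ := eventually_atTop.1 (eventually_geom_sum_lt hs0 (by linarith : s < _))
  refine ⟨max 2 n₀, fun n hn ζ hζ => sSup_le ?_⟩
  rintro _ ⟨ν, hν, rfl⟩
  have hn2 : 2 ≤ n := (le_max_left _ _).trans hn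
  refine EReal.coe_le_coe_iff.2 (not_lt.1 fun hlt => ?_)
  have hU : HasUniformApprox n ζ (2 * n - 1 - s) :=
    (hasUniformApprox_of_eventually hν).mono (by linarith [min_le_left ε (1 / 2)])
  obtain ⟨P, hP⟩ := exists_isBestApproxSeq n (by omega) ζ hζ
  exact absurd (hU.le_geom_sum hn2 hζ (by linarith) (by linarith) hP (hconj n (by omega) ζ hζ P hP))
    (not_le.2 (hn₀ n ((le_max_right _ _).trans hn)))
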